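/- Let $A$ be an abelian group, let $B$ be a subgroup of $A$, and let $l\ge 0$ be an integer such that $A/B$ is $l$-torsion (every element of $A/B$ is killed by some power of $l$; for instance, $A/B$ is killed by $l$). The group $A/B$ need not be finite. Let $R=\mathbb{Z}[1/l]$ and let $M$ be an $R[A]$-module. Write $M_B=M/\langle bm-m \mid b\in B,\, m\in M\rangle$, with the action of $A$ induced from $M$, and $M_A=M/\langle am-m \mid a\in A,\, m\in M\rangle$, with the trivial action of $A$. Then for every $n\ge 0$ the natural map $M_B\to M_A$ induces an isomorphism of group homology $$H_n(A,M_B)\xrightarrow{\ \simeq\ } H_n(A,M_A).$$ In particular, if $B$ acts trivially on $M$, then the quotient map $M\to M_A$ induces an isomorphism $$H_n(A,M)\xrightarrow{\ \simeq\ } H_n(A,M_A)$$ for every $n\ge 0$. -/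

import Mathlib

open CategoryTheory

universe u

noncomputable section

namespace AbelianCoinvariants

/-- A group `Q` is `l`-torsion if each of its elements is killed by a power of `l`.
Groups in which every element is killed by `l` itself are the case where the power is `l ^ 1`. -/
def IsTorsionGroup (l : ℕ) (Q : Type u) [Group Q] : Prop :=
  ∀ q : Q, ∃ j : ℕ, q ^ l ^ j = 1

variable {R A : Type u} [CommRing R] [CommGroup A]

/-- The module `M_A = M / ⟨gm - m⟩` of coinvariants, with the trivial action of `A`. -/
abbrev coinv (M : Rep.{u} R A) : Rep.{u} R A :=
  Rep.trivial R A M.ρ.Coinvariants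

/-- The quotient map `M ⟶ M_A`, as a morphism of `A`-modules. -/
def toCoinv (M : Rep.{u} R A) : M ⟶ coinv M :=
  Rep.ofHom ⟨Representation.Coinvariants.mk M.ρ, fun g => by
    ext x; exact Representation.Coinvariants.mk_self_apply M.ρ g x⟩

/-- The natural map `M_B ⟶ M_A`, sending the class of `m` to the class of `m`, as a morphism of
`A`-modules. Here `M_B` carries the action of `A` induced by the action on `M`. -/
def coinvMap (M : Rep.{u} R A) (B : Subgroup A) : M.toCoinvariants B ⟶ coinv M :=
  Rep.ofHom ⟨Representation.Coinvariants.lift (M.ρ.comp B.subtype)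
      (Representation.Coinvariants.mk M.ρ) (fun b => by
        ext x; exact Representation.Coinvariants.mk_self_apply M.ρ (b : A) x), fun g => by
    ext x; exact Representation.Coinvariants.mk_self_apply M.ρ g x⟩

end AbelianCoinvariants

end

/-!
Write `Q = A ⧸ B`. Both maps in question are epimorphisms `f : N ⟶ P` of `A`-modules on whose
source `B` acts trivially and whose kernel `K` is spanned by the elements `gm - m`, so by the long
exact homology sequence it suffices that `H_n(A, K) = 0` for all `n`.

Since `A` is abelian, each element `t` of the group algebra `R[A]` acts on the coefficients by an
`A`-endomorphism, and hence on homology. A group element acts trivially on homology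
(`map_applyAsHom`): this is clear for `H_0`, and follows in general by dimension shifting along an
epimorphism from an induced module. By linearity `t` acts on `H_n` through its augmentation
(`map_smulHom`).

If a power `k` of `l` satisfies `g ^ k ∈ B`, then `k` is invertible in `R`, and
`t = k⁻¹ (1 + g + ⋯ + g ^ (k - 1))` has augmentation `1` and kills `gm - m`, because
`t (g - 1) = k⁻¹ (g ^ k - 1)`. Products of such `t` kill any given finite set of elements of `K`, in
particular all the coefficients of a given cycle `z` (`exists_aug_eq_one_of_mem_ker`,
`exists_forall_mem_asAlgebraHom_eq_zero`). Then the class of `z` is equal to `t` times itself, which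
is zero (`isZero_groupHomology_of_forall_exists`).
-/

theorem Finsupp.mapRange_linearMap_add {R α V W : Type*} [CommRing R] [AddCommGroup V]
    [AddCommGroup W] [Module R V] [Module R W] (f g : V →ₗ[R] W) :
    Finsupp.mapRange.linearMap (α := α) (f + g) =
      Finsupp.mapRange.linearMap f + Finsupp.mapRange.linearMap g := by
  ext; simp

theorem Finsupp.mapRange_linearMap_smul {R α V W : Type*} [CommRing R] [AddCommGroup V]
    [AddCommGroup W] [Module R V] [Module R W] (r : R) (f : V →ₗ[R] W) :
    Finsupp.mapRange.linearMap (α := α) (r • f) = r • Finsupp.mapRange.linearMap f := by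
  ext; simp

noncomputable section

namespace AbelianCoinvariants

open Limits groupHomology Representation

section Group

variable {R G : Type u} [CommRing R] [Group G]

theorem functor_map_add {M N : Rep.{u} R G} (f g : M ⟶ N) (n : ℕ) :
    (groupHomology.functor R G n).map (f + g) =
      (groupHomology.functor R G n).map f + (groupHomology.functor R G n).map g := by
  have h : chainsMap (MonoidHom.id G) (f + g) =
      chainsMap (MonoidHom.id G) f + chainsMap (MonoidHom.id G) g := by
    refine HomologicalComplex.hom_ext _ _ fun i => ModuleCat.hom_ext ?_
    rw [HomologicalComplex.add_f_apply, ModuleCat.hom_add, chainsMap_id_f_hom_eq_mapRange,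
      chainsMap_id_f_hom_eq_mapRange, chainsMap_id_f_hom_eq_mapRange]
    exact Finsupp.mapRange_linearMap_add f.hom.toLinearMap g.hom.toLinearMap
  exact (congrArg (fun t => HomologicalComplex.homologyMap t n) h).trans
    (HomologicalComplex.homologyMap_add _ _ _)

theorem functor_map_smul {M N : Rep.{u} R G} (r : R) (f : M ⟶ N) (n : ℕ) :
    (groupHomology.functor R G n).map (r • f) = r • (groupHomology.functor R G n).map f := by
  have h : chainsMap (MonoidHom.id G) (r • f) = r • chainsMap (MonoidHom.id G) f := by
    refine HomologicalComplex.hom_ext _ _ fun i => ModuleCat.hom_ext ?_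
    rw [HomologicalComplex.smul_f_apply, ModuleCat.hom_smul, chainsMap_id_f_hom_eq_mapRange,
      chainsMap_id_f_hom_eq_mapRange]
    exact Finsupp.mapRange_linearMap_smul r f.hom.toLinearMap
  refine (congrArg (fun t => HomologicalComplex.homologyMap t n) h).trans ?_
  exact ShortComplex.homologyMap_smul
    ((HomologicalComplex.shortComplexFunctor (ModuleCat R) _ n).map
      (chainsMap (MonoidHom.id G) f)) r

/-- Every representation is a quotient of one without higher homology: the representation induced
from the trivial subgroup, which is acyclic by Shapiro's lemma. -/
theorem exists_epi_of_acyclic (M : Rep.{u} R G) : ∃ (P : Rep.{u} R G) (p : P ⟶ M), Epi p ∧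
    ∀ n, IsZero (groupHomology P (n + 1)) := by
  classical
  refine ⟨Rep.ind (⊥ : Subgroup G).subtype (Rep.res (⊥ : Subgroup G).subtype M),
    (Rep.indResAdjunction.{u} R (⊥ : Subgroup G).subtype).counit.app M, inferInstance, fun n => ?_⟩
  exact (isZero_groupHomology_succ_of_subsingleton _ n).of_iso (indIso ⊥ _ (n + 1))

theorem shortExact_kernel {M N : Rep.{u} R G} (p : M ⟶ N) [Epi p] :
    (ShortComplex.mk (kernel.ι p) p (kernel.condition p)).ShortExact where
  exact := ShortComplex.exact_kernel p

end Group

variable {R G : Type u} [CommRing R] [CommGroup G]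

/-- An element of an abelian group, acting on the coefficients, acts trivially on homology. -/
theorem map_applyAsHom (n : ℕ) (M : Rep.{u} R G) (g : G) :
    (groupHomology.functor R G n).map (M.applyAsHom g) = 𝟙 _ := by
  induction n generalizing M with
  | zero =>
    refine (cancel_mono (H0Iso M).hom).1 ((map_id_comp_H0Iso_hom _).trans ?_)
    refine Eq.trans ?_ (Category.id_comp _).symm
    refine (congrArg (fun t => (H0Iso M).hom ≫ t) ?_).trans (Category.comp_id _)
    refine Rep.coinvariantsFunctor_hom_ext ?_
    ext x
    exact Coinvariants.mk_self_apply M.ρ g x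
  | succ n ih =>
    -- The connecting map `H_{n+1}(M) ⟶ H_n(kernel p)` is injective and commutes with `g`.
    obtain ⟨P, p, hp, hP⟩ := exists_epi_of_acyclic M
    have hX := shortExact_kernel p
    have := mono_δ_of_isZero hX n (hP n)
    let α : ShortComplex.mk (kernel.ι p) p (kernel.condition p) ⟶
        ShortComplex.mk (kernel.ι p) p (kernel.condition p) :=
      { τ₁ := Rep.applyAsHom _ g
        τ₂ := Rep.applyAsHom _ g
        τ₃ := Rep.applyAsHom _ g
        comm₁₂ := Rep.applyAsHom_comm _ _
        comm₂₃ := Rep.applyAsHom_comm _ _ }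
    have nat := HomologicalComplex.HomologySequence.δ_naturality
      ((chainsFunctor R G).mapShortComplex.map α) (map_chainsFunctor_shortExact hX)
      (map_chainsFunctor_shortExact hX) (n + 1) n rfl
    refine (cancel_mono (δ hX (n + 1) n rfl)).1 (nat.symm.trans ?_)
    refine (congrArg (fun t => δ hX (n + 1) n rfl ≫ t) (ih (kernel p))).trans ?_
    exact (Category.comp_id _).trans (Category.id_comp _).symm

/-- The action of an element of the group algebra of an abelian group on a representation, as an
endomorphism of the representation. -/
def smulHom (M : Rep.{u} R G) (t : MonoidAlgebra R G) : M ⟶ M :=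
  Rep.ofHom ⟨M.ρ.asAlgebraHom t, fun g => by
    rw [← asAlgebraHom_single_one, ← Module.End.mul_eq_comp, ← Module.End.mul_eq_comp,
      ← map_mul, ← map_mul, mul_comm]⟩

/-- The augmentation `R[G] → R`, sending each group element to `1`. -/
def aug : MonoidAlgebra R G →ₐ[R] R := MonoidAlgebra.lift R R G 1

theorem map_smulHom (n : ℕ) (M : Rep.{u} R G) (t : MonoidAlgebra R G) :
    (groupHomology.functor R G n).map (smulHom M t) = aug t • 𝟙 _ := by
  induction t using MonoidAlgebra.induction_linear with
  | zero =>
    have : smulHom M 0 = 0 :=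
      Rep.hom_ext (IntertwiningMap.ext (map_zero M.ρ.asAlgebraHom))
    rw [this, Functor.map_zero, map_zero, zero_smul]
  | add s t hs ht =>
    have : smulHom M (s + t) = smulHom M s + smulHom M t :=
      Rep.hom_ext (IntertwiningMap.ext (map_add M.ρ.asAlgebraHom s t))
    rw [this, functor_map_add, hs, ht, map_add, add_smul]
  | single g r =>
    have : smulHom M (MonoidAlgebra.single g r) = r • M.applyAsHom g :=
      Rep.hom_ext (IntertwiningMap.ext (asAlgebraHom_single M.ρ g r))
    rw [this, functor_map_smul, map_applyAsHom]
    simp [aug]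

theorem smulHom_comp {M N : Rep.{u} R G} (f : M ⟶ N) (t : MonoidAlgebra R G) :
    smulHom M t ≫ f = f ≫ smulHom N t := by
  refine Rep.hom_ext (IntertwiningMap.ext (LinearMap.ext fun m => ?_))
  change f.hom (M.ρ.asAlgebraHom t m) = N.ρ.asAlgebraHom t (f.hom m)
  induction t using MonoidAlgebra.induction_linear with
  | zero => simp
  | add s t hs ht => simp [hs, ht]
  | single g r => simp [Rep.hom_comm_apply]

/-- If each of finitely many vectors is killed by an element of augmentation `1`, then so are all of
them at once, by the product of these elements. -/
theorem exists_forall_mem_asAlgebraHom_eq_zero {V : Type*} [AddCommGroup V] [Module R V]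
    (ρ : Representation R G V) (s : Finset V)
    (hs : ∀ v ∈ s, ∃ t : MonoidAlgebra R G, aug t = 1 ∧ ρ.asAlgebraHom t v = 0) :
    ∃ t : MonoidAlgebra R G, aug t = 1 ∧ ∀ v ∈ s, ρ.asAlgebraHom t v = 0 := by
  classical
  choose! t ht h using hs
  refine ⟨∏ v ∈ s, t v, by rw [map_prod]; exact Finset.prod_eq_one ht, fun v hv => ?_⟩
  rw [← Finset.prod_erase_mul s t hv, map_mul, Module.End.mul_apply, h v hv, map_zero]

/-- Homology vanishes if each coefficient is killed by an element of augmentation `1`: one such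
element kills all coefficients of a given cycle, and acts as the identity on homology. -/
theorem isZero_groupHomology_of_forall_exists (n : ℕ) (M : Rep.{u} R G)
    (hM : ∀ m : M, ∃ t : MonoidAlgebra R G, aug t = 1 ∧ M.ρ.asAlgebraHom t m = 0) :
    IsZero (groupHomology M n) := by
  have key : ∀ c : (Fin n → G) →₀ M, ∃ t : MonoidAlgebra R G, aug t = 1 ∧
      Finsupp.mapRange.linearMap (M.ρ.asAlgebraHom t) c = 0 := by
    classical
    intro c
    obtain ⟨t, ht, h⟩ :=
      exists_forall_mem_asAlgebraHom_eq_zero M.ρ (c.support.image c) fun m _ => hM m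
    refine ⟨t, ht, Finsupp.ext fun x => ?_⟩
    by_cases hx : x ∈ c.support
    · exact h _ (Finset.mem_image_of_mem c hx)
    · simp [Finsupp.notMem_support_iff.1 hx]
  have : Subsingleton (groupHomology M n) := by
    refine subsingleton_of_forall_eq 0 fun x => ?_
    induction x using groupHomology_induction_on with
    | h z =>
    obtain ⟨t, ht, hz⟩ := key (iCycles M n z)
    have h1 : cyclesMap (MonoidHom.id G) (smulHom M t) n z = 0 := by
      apply (ModuleCat.mono_iff_injective (iCycles M n)).1 inferInstance
      rw [map_zero]
      refine congr($(HomologicalComplex.cyclesMap_i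
        (chainsMap (MonoidHom.id G) (smulHom M t)) n) z).trans ?_
      simp only [ModuleCat.hom_comp, LinearMap.comp_apply]
      exact (congr($(chainsMap_id_f_hom_eq_mapRange n (smulHom M t)) _)).trans hz
    have h2 := congr($(π_map (MonoidHom.id G) (smulHom M t) n) z)
    have h3 := congr($(map_smulHom n M t) (π M n z))
    rw [ht, one_smul] at h3
    exact h3.symm.trans (h2.trans ((congrArg (π M n) h1).trans (map_zero _)))
  exact ModuleCat.isZero_of_subsingleton _

theorem isIso_map_of_forall_exists (n : ℕ) {M N : Rep.{u} R G} (f : M ⟶ N) [Epi f]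
    (hM : ∀ m : M, f.hom m = 0 →
      ∃ t : MonoidAlgebra R G, aug t = 1 ∧ M.ρ.asAlgebraHom t m = 0) :
    IsIso ((groupHomology.functor R G n).map f) := by
  have hX := shortExact_kernel f
  have hK : ∀ n, IsZero (groupHomology (kernel f) n) := by
    refine fun n => isZero_groupHomology_of_forall_exists n _ fun m => ?_
    obtain ⟨t, ht, h⟩ := hM ((kernel.ι f).hom m) congr(($(kernel.condition f)).hom m)
    refine ⟨t, ht, (Rep.mono_iff_injective (kernel.ι f)).1 inferInstance ?_⟩
    rw [map_zero, ← h]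
    exact congr(($(smulHom_comp (kernel.ι f) t)).hom m)
  have hmono : Mono ((groupHomology.functor R G n).map f) :=
    (mapShortComplex₂_exact hX n).mono_g ((hK n).eq_of_src _ _)
  have hepi : Epi ((groupHomology.functor R G n).map f) := by
    cases n with
    | zero => exact epi_map_0_of_epi f
    | succ n => exact (mapShortComplex₃_exact hX rfl).epi_f ((hK n).eq_of_tgt _ _)
  exact isIso_of_mono_of_epi _

theorem exists_aug_eq_one_of_mem_ker {M : Rep.{u} R G} (B : Subgroup G)
    (hB : ∀ b ∈ B, ∀ m : M, M.ρ b m = m)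
    (hG : ∀ g : G, ∃ k : ℕ, IsUnit (k : R) ∧ g ^ k ∈ B) {m : M}
    (hm : m ∈ Coinvariants.ker M.ρ) :
    ∃ t : MonoidAlgebra R G, aug t = 1 ∧ M.ρ.asAlgebraHom t m = 0 := by
  induction hm using Submodule.span_induction with
  | mem x hx =>
    obtain ⟨⟨g, y⟩, rfl⟩ := hx
    obtain ⟨k, ⟨u, hu⟩, hk⟩ := hG g
    -- The average of the powers of `g` kills `g y - y`, since `g ^ k` acts trivially.
    refine ⟨(↑u⁻¹ : R) • ∑ j ∈ Finset.range k, MonoidAlgebra.of R G g ^ j, ?_, ?_⟩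
    · have : aug (MonoidAlgebra.of R G g) = 1 := by simp [aug]
      rw [map_smul, map_sum]
      simp only [map_pow, this, one_pow, Finset.sum_const, Finset.card_range, nsmul_one]
      rw [← hu, smul_eq_mul, Units.inv_mul]
    · rw [map_smul, LinearMap.smul_apply]
      have h : M.ρ g y - y = M.ρ.asAlgebraHom (MonoidAlgebra.of R G g - 1) y := by
        rw [map_sub, asAlgebraHom_of, map_one]; rfl
      change _ • M.ρ.asAlgebraHom _ (M.ρ g y - y) = 0
      rw [h, ← Module.End.mul_apply, ← map_mul, geom_sum_mul, ← map_pow, map_sub, asAlgebraHom_of,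
        map_one, LinearMap.sub_apply, hB _ hk, Module.End.one_apply, sub_self, smul_zero]
  | zero => exact ⟨1, map_one _, map_zero _⟩
  | add x y _ _ hx hy =>
    classical
    obtain ⟨t, ht, h⟩ := exists_forall_mem_asAlgebraHom_eq_zero M.ρ {x, y} (by simp [hx, hy])
    exact ⟨t, ht, by rw [map_add, h x (by simp), h y (by simp), add_zero]⟩
  | smul r x _ hx =>
    obtain ⟨t, ht, h⟩ := hx
    exact ⟨t, ht, by rw [map_smul, h, smul_zero]⟩

theorem exists_isUnit_pow_mem {B : Subgroup G} {l : ℕ} (hl : IsTorsionGroup l (G ⧸ B))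
    [IsLocalization.Away (l : ℤ) R] (g : G) : ∃ k : ℕ, IsUnit (k : R) ∧ g ^ k ∈ B := by
  obtain ⟨j, hj⟩ := hl (g : G ⧸ B)
  refine ⟨l ^ j, ?_, (QuotientGroup.eq_one_iff _).1 hj⟩
  have := IsLocalization.Away.algebraMap_isUnit (S := R) (l : ℤ)
  simpa using this.pow j

instance epi_toCoinv (M : Rep.{u} R G) : Epi (toCoinv M) :=
  (Rep.epi_iff_surjective _).2 (Coinvariants.mk_surjective _)

instance epi_coinvMap (M : Rep.{u} R G) (B : Subgroup G) : Epi (coinvMap M B) :=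
  (Rep.epi_iff_surjective _).2 fun y => by
    obtain ⟨x, rfl⟩ := Coinvariants.mk_surjective _ y
    exact ⟨Coinvariants.mk _ x, rfl⟩

theorem mem_ker_of_coinvMap_eq_zero {M : Rep.{u} R G} {B : Subgroup G} {x : M.toCoinvariants B}
    (hx : (coinvMap M B).hom x = 0) : x ∈ Coinvariants.ker (M.toCoinvariants B).ρ := by
  obtain ⟨x, rfl⟩ := Coinvariants.mk_surjective _ x
  have hle : Coinvariants.ker M.ρ ≤ (Coinvariants.ker (M.toCoinvariants B).ρ).comap
      (Coinvariants.mk (M.ρ.comp B.subtype)) := Submodule.span_le.2 <| by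
    rintro _ ⟨⟨g, m⟩, rfl⟩
    exact Coinvariants.mem_ker_of_eq g (Coinvariants.mk _ m) _
      (map_sub (Coinvariants.mk _) (M.ρ g m) m).symm
  exact hle ((Coinvariants.mk_eq_zero _).1 hx)

theorem toCoinvariants_ρ_apply_of_mem {M : Rep.{u} R G} {B : Subgroup G} {b : G} (hb : b ∈ B)
    (x : M.toCoinvariants B) : (M.toCoinvariants B).ρ b x = x := by
  obtain ⟨x, rfl⟩ := Coinvariants.mk_surjective _ x
  exact Coinvariants.mk_self_apply (M.ρ.comp B.subtype) ⟨b, hb⟩ x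

end AbelianCoinvariants

end

/-- `R` is `ℤ[1/l]` and `M` is an `R[A]`-module. The isomorphisms are the maps that the natural
maps `M_B ⟶ M_A` and `M ⟶ M_A` induce on group homology. -/
theorem corollary1p6 {A : Type u} [CommGroup A] (B : Subgroup A) (l : ℕ)
    (hl : AbelianCoinvariants.IsTorsionGroup l (A ⧸ B))
    (R : Type u) [CommRing R] [IsLocalization.Away (l : ℤ) R] (M : Rep.{u} R A) (n : ℕ) :
    IsIso ((groupHomology.functor R A n).map (AbelianCoinvariants.coinvMap M B)) ∧
    ((∀ b ∈ B, ∀ m : M, M.ρ b m = m) →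
      IsIso ((groupHomology.functor R A n).map (AbelianCoinvariants.toCoinv M))) :=
  ⟨AbelianCoinvariants.isIso_map_of_forall_exists n _ fun _ hx =>
      AbelianCoinvariants.exists_aug_eq_one_of_mem_ker B
        (fun _ => AbelianCoinvariants.toCoinvariants_ρ_apply_of_mem)
        (AbelianCoinvariants.exists_isUnit_pow_mem hl)
        (AbelianCoinvariants.mem_ker_of_coinvMap_eq_zero hx),
    fun hB => AbelianCoinvariants.isIso_map_of_forall_exists n _ fun _ hx =>
      AbelianCoinvariants.exists_aug_eq_one_of_mem_ker B hB
        (AbelianCoinvariants.exists_isUnit_pow_mem hl)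
        ((Representation.Coinvariants.mk_eq_zero _).1 hx)⟩
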